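/- Let $G=(V,E)$ be a finite, simple, loopless, connected graph. A spanning tree of $G$ is a maximal acyclic subset $T\subseteq E$. For positive real edge weights $c=(c_e)_{e\in E}$, the relative resistance of an edge $e\in E$ is $$r_e(c)=\frac{\sum_{T\ni e}\prod_{t\in T}c_t}{\sum_{T}\prod_{t\in T}c_t},$$ where $T$ ranges over the spanning trees of $G$, and the resistance curvature of a vertex $v\in V$ is $$p_v(c)=1-\tfrac12\sum_{u\in V:\,uv\in E}r_{uv}(c).$$ The graph $G$ is called resistance nonnegative if there are weights $c$ with $0<c_e<\infty$ for all $e\in E$ such that $p_v(c)\ge 0$ for all $v\in V$. If $G$ is resistance nonnegative, then $G$ has a perfect matching (a matching covering every vertex) when $|V|$ is even, and a near-perfect matching (a matching covering all vertices except exactly one) when $|V|$ is odd. -/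

import Mathlib

namespace ResistanceCurvature

variable {V : Type*}

/-- A spanning tree of `G`: a maximal acyclic subset of the edges of `G`. -/
def IsSpanningTree (G : SimpleGraph V) (T : Finset (Sym2 V)) : Prop :=
  Maximal (fun S : Finset (Sym2 V) =>
    (S : Set (Sym2 V)) ⊆ G.edgeSet ∧
      (SimpleGraph.fromEdgeSet (S : Set (Sym2 V))).IsAcyclic) T

open Classical in
/-- The finite set `𝒯(G)` of all spanning trees of `G`. -/
noncomputable def spanningTrees [Fintype V] (G : SimpleGraph V) : Finset (Finset (Sym2 V)) :=
  Finset.univ.filter (fun T => IsSpanningTree G T)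

/-- The Kirchhoff polynomial `∑_T ∏_{t ∈ T} c_t` evaluated at the weights `c`. Here and below, only
the values of `c` on the edges of `G` matter. -/
noncomputable def kirchhoff [Fintype V] (G : SimpleGraph V) (c : Sym2 V → ℝ) : ℝ :=
  ∑ T ∈ spanningTrees G, ∏ t ∈ T, c t

open Classical in
/-- The relative resistance
`r_e(c) = (∑_{T ∋ e} ∏_{t ∈ T} c_t) / (∑_T ∏_{t ∈ T} c_t)` of an edge `e`. -/
noncomputable def relativeResistance [Fintype V] (G : SimpleGraph V) (c : Sym2 V → ℝ)
    (e : Sym2 V) : ℝ :=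
  (∑ T ∈ (spanningTrees G).filter (fun T => e ∈ T), ∏ t ∈ T, c t) / kirchhoff G c

open Classical in
/-- The resistance curvature `p_v(c) = 1 - (1/2) ∑_{uv ∈ E} r_{uv}(c)` of a vertex `v`. -/
noncomputable def resistanceCurvature [Fintype V] (G : SimpleGraph V) (c : Sym2 V → ℝ)
    (v : V) : ℝ :=
  1 - 1 / 2 * ∑ u ∈ Finset.univ.filter (fun u => G.Adj u v), relativeResistance G c s(u, v)

/-- `G` is resistance nonnegative: for some positive edge weights all vertices have nonnegative
resistance curvature. -/
def IsResistanceNonnegative [Fintype V] (G : SimpleGraph V) : Prop :=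
  ∃ c : Sym2 V → ℝ, (∀ e ∈ G.edgeSet, 0 < c e) ∧ ∀ v : V, 0 ≤ resistanceCurvature G c v

/-- A near-perfect matching: a matching that covers all vertices except exactly one. -/
def IsNearPerfectMatching {G : SimpleGraph V} (M : G.Subgraph) : Prop :=
  M.IsMatching ∧ ∃! v : V, v ∉ M.verts

end ResistanceCurvature

/-!
Weight each spanning tree `T` by `∏_{t ∈ T} c_t`. The relative resistance of `e` is the probability
that the random spanning tree contains `e`, so `0 ≤ p_v` says that the expected degree of `v` in
the tree is at most `2`. For every vertex set `U` some spanning tree `T` therefore has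
`∑_{v ∈ U} deg_T v ≤ 2 |U|` (`exists_connected_sum_degree_le`).

Contract every connected component of `G - U` to a point. The image of `T` is a connected graph
on `|U| + c(G - U)` vertices, and all of its edges come from edges of `T` that meet `U`, so
`|U| + c(G - U) ≤ 2 |U| + 1` (`card_connectedComponent_deleteVerts_le`). Hence
`c(G - U) ≤ |U| + 1` for all `U`.

If `|V|` is even, the number of odd components of `G - U` has the parity of `|U|`, so it is
at most `|U|`, and Tutte's theorem gives a perfect matching. If `|V|` is odd, the same argument
applies to the cone over `G`: deleting `U` together with the apex leaves `G - U`, and deleting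
any set without the apex leaves a connected graph. A perfect matching of the cone
restricts to a matching of `G` that misses exactly the partner of the apex.
-/

namespace SimpleGraph

variable {V W : Type*} {G : SimpleGraph V}

/-! ### Counting components by contraction -/

theorem Reachable.map_fun (f : V → W) {u v : V} (h : G.Reachable u v) :
    (G.map f).Reachable (f u) (f v) := by
  obtain ⟨p⟩ := h
  induction p with
  | nil => exact Reachable.refl _
  | @cons a b c hab p ih =>
    by_cases hf : f a = f b
    · rwa [hf]
    · exact (Adj.reachable (G := G.map f) ⟨hf, a, b, hab, rfl, rfl⟩).trans ih

open Classical in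
/-- Contracting the components of `G - U` turns a connected spanning subgraph `T` of `G` into a
connected graph whose edges all come from edges of `T` meeting `U`; a connected graph has at
most one more vertex than it has edges. -/
theorem card_connectedComponent_deleteVerts_le [Fintype V] {T : SimpleGraph V}
    (hT : T.Connected) (hle : T ≤ G) (U : Set V) :
    U.ncard + Nat.card ((⊤ : G.Subgraph).deleteVerts U).coe.ConnectedComponent ≤
      ∑ v ∈ U.toFinset, T.degree v + 1 := by
  set H := ((⊤ : G.Subgraph).deleteVerts U).coe
  let f : V → U ⊕ H.ConnectedComponent := fun v =>
    if h : v ∈ U then .inl ⟨v, h⟩ else .inr (H.connectedComponentMk ⟨v, by simp [h]⟩)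
  have hf : Function.Surjective f := by
    rintro (⟨v, hv⟩ | c)
    · exact ⟨v, by simp [f, hv]⟩
    · induction c using ConnectedComponent.ind with
      | h v => exact ⟨v, by simp [f, v.2.2]⟩
  have hconn : (T.map f).Connected := by
    refine { preconnected := fun a b => ?_, nonempty := hT.nonempty.map f }
    obtain ⟨x, rfl⟩ := hf a
    obtain ⟨y, rfl⟩ := hf b
    exact (hT.preconnected x y).map_fun f
  have hsub : (T.map f).edgeSet ⊆
      ↑(U.toFinset.biUnion fun v => (T.neighborFinset v).image fun w => s(f v, f w)) := by
    intro e he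
    induction e using Sym2.ind with
    | h a b =>
      obtain ⟨hne, x, y, hxy, rfl, rfl⟩ := he
      simp only [Finset.coe_biUnion, Finset.coe_image, Set.mem_iUnion, Set.mem_image,
        Finset.mem_coe, Set.mem_toFinset, mem_neighborFinset]
      by_cases hx : x ∈ U
      · exact ⟨x, hx, y, hxy, rfl⟩
      by_cases hy : y ∈ U
      · exact ⟨y, hy, x, hxy.symm, Sym2.eq_swap⟩
      -- An edge of `T` avoiding `U` joins two vertices of one component, so it is contracted.
      · refine absurd ?_ hne
        simp only [f, hx, hy, dite_false, Sum.inr.injEq]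
        refine ConnectedComponent.sound (Adj.reachable ?_)
        simp [H, hx, hy, hle hxy]
  have hcard := hconn.card_vert_le_card_edgeSet_add_one
  have hedges : Nat.card (T.map f).edgeSet ≤ ∑ v ∈ U.toFinset, T.degree v := by
    rw [Nat.card_coe_set_eq]
    refine (Set.ncard_le_ncard hsub (Finset.finite_toSet _)).trans ?_
    rw [Set.ncard_coe_finset]
    exact Finset.card_biUnion_le.trans (Finset.sum_le_sum fun v _ => Finset.card_image_le)
  rw [Nat.card_sum, Nat.card_coe_set_eq] at hcard
  omega

/-! ### Tutte's theorem and the cone over a graph -/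

/-- In a graph of even order, the number of odd components left by a Tutte violator exceeds its size
by at least `2`, because the two numbers have the same parity. -/
theorem IsTutteViolator.ncard_add_two_le [Finite V] (hV : Even (Nat.card V)) {U : Set V}
    (h : G.IsTutteViolator U) :
    U.ncard + 2 ≤ ((⊤ : G.Subgraph).deleteVerts U).coe.oddComponents.ncard := by
  have hodd := ((⊤ : G.Subgraph).deleteVerts U).coe.odd_ncard_oddComponents
  have hcard : Nat.card ((⊤ : G.Subgraph).deleteVerts U).verts + U.ncard = Nat.card V := by
    rw [Nat.card_coe_set_eq, Subgraph.deleteVerts_verts, Subgraph.verts_top,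
      Set.ncard_sdiff_add_ncard_of_subset (Set.subset_univ U), Set.ncard_univ]
  unfold IsTutteViolator at h
  rw [Nat.odd_iff, Nat.odd_iff] at hodd
  rw [Nat.even_iff] at hV
  omega

theorem exists_isPerfectMatching_of_card_connectedComponent_le [Finite V] (hV : Even (Nat.card V))
    (h : ∀ U : Set V,
      Nat.card ((⊤ : G.Subgraph).deleteVerts U).coe.ConnectedComponent ≤ U.ncard + 1) :
    ∃ M : G.Subgraph, M.IsPerfectMatching := by
  refine tutte.2 fun U hU => ?_
  have h1 := hU.ncard_add_two_le hV
  have h2 := Set.ncard_le_card ((⊤ : G.Subgraph).deleteVerts U).coe.oddComponents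
  have h3 := h U
  omega

/-- The cone over `G`: the graph `G` together with a new vertex `none` adjacent to all others. -/
def cone (G : SimpleGraph V) : SimpleGraph (Option V) where
  Adj
    | some u, some v => G.Adj u v
    | none, none => False
    | _, _ => True
  symm := ⟨by rintro (_ | u) (_ | v) <;> simp [G.adj_comm]⟩
  loopless := ⟨by rintro (_ | u) <;> simp⟩

@[simp] theorem cone_adj_some_some {u v : V} : G.cone.Adj (some u) (some v) ↔ G.Adj u v := Iff.rfl

@[simp] theorem cone_adj_none_some {v : V} : G.cone.Adj none (some v) := trivial

theorem card_connectedComponent_cone_deleteVerts_le [Finite V]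
    (h : ∀ U : Set V,
      Nat.card ((⊤ : G.Subgraph).deleteVerts U).coe.ConnectedComponent ≤ U.ncard + 1)
    (U : Set (Option V)) :
    Nat.card ((⊤ : G.cone.Subgraph).deleteVerts U).coe.ConnectedComponent ≤ U.ncard + 1 := by
  by_cases hU : none ∈ U
  · let φ : ((⊤ : G.Subgraph).deleteVerts (some ⁻¹' U)).coe →g
        ((⊤ : G.cone.Subgraph).deleteVerts U).coe :=
      { toFun := fun v => ⟨some v, trivial, v.2.2⟩
        map_rel' := by
          rintro ⟨a, ha⟩ ⟨b, hb⟩ hab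
          have ha' : some a ∉ U := ha.2
          have hb' : some b ∉ U := hb.2
          simpa [ha', hb'] using hab }
    have hφ : Function.Surjective (ConnectedComponent.map φ) := by
      intro c
      induction c using ConnectedComponent.ind with
      | h v =>
        obtain ⟨_ | v, hv⟩ := v
        · exact absurd hU hv.2
        · exact ⟨connectedComponentMk _ ⟨v, trivial, hv.2⟩, rfl⟩
    refine (Nat.card_le_card_of_surjective _ hφ).trans ((h _).trans ?_)
    gcongr
    rw [← Set.ncard_image_of_injective _ (Option.some_injective V)]
    exact Set.ncard_le_ncard (Set.image_preimage_subset _ _)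
  · -- The apex survives and is adjacent to every other remaining vertex.
    have hapex : ∀ v,
        ((⊤ : G.cone.Subgraph).deleteVerts U).coe.Reachable ⟨none, trivial, hU⟩ v := by
      rintro ⟨_ | v, hv⟩
      · exact Reachable.refl _
      · have hv' : some v ∉ U := hv.2
        refine Adj.reachable ?_
        simp [hU, hv']
    have : Subsingleton ((⊤ : G.cone.Subgraph).deleteVerts U).coe.ConnectedComponent :=
      Preconnected.subsingleton_connectedComponent fun a b => (hapex a).symm.trans (hapex b)
    exact Finite.card_le_one_iff_subsingleton.2 this |>.trans (Nat.le_add_left 1 _)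

theorem exists_isNearPerfectMatching_of_cone {M : G.cone.Subgraph} (hM : M.IsPerfectMatching) :
    ∃ N : G.Subgraph, ResistanceCurvature.IsNearPerfectMatching N := by
  let N : G.Subgraph :=
    { verts := {v | ∃ w, M.Adj (some v) (some w)}
      Adj := fun v w => M.Adj (some v) (some w)
      adj_sub := fun h => M.adj_sub h
      edge_vert := fun h => ⟨_, h⟩
      symm := ⟨fun _ _ h => M.adj_symm h⟩ }
  refine ⟨N, ?_, ?_⟩
  · rintro v ⟨w, hw⟩
    exact ⟨w, hw, fun w' hw' => Option.some_injective _ (hM.1.eq_of_adj_left hw' hw)⟩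
  · obtain ⟨_ | v, hv, -⟩ := hM.1 (hM.2 none)
    · exact absurd (M.adj_sub hv) (G.cone.irrefl)
    refine ⟨v, ?_, fun u hu => ?_⟩
    · rintro ⟨w, hw⟩
      exact Option.some_ne_none _ (hM.1.eq_of_adj_left hw hv.symm)
    · obtain ⟨_ | w, hw, -⟩ := hM.1 (hM.2 (some u))
      · exact Option.some_injective _ (hM.1.eq_of_adj_left hw.symm hv)
      · exact absurd ⟨w, hw⟩ hu

end SimpleGraph

namespace ResistanceCurvature

variable {V : Type*} {G : SimpleGraph V}

/-! ### Spanning trees of small total degree on a vertex set -/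

theorem IsSpanningTree.le {T : Finset (Sym2 V)} (hT : IsSpanningTree G T) :
    SimpleGraph.fromEdgeSet (T : Set (Sym2 V)) ≤ G :=
  (SimpleGraph.fromEdgeSet_le G).2 (Set.sdiff_subset.trans hT.prop.1)

theorem IsSpanningTree.connected [Finite V] (hG : G.Connected) {T : Finset (Sym2 V)}
    (hT : IsSpanningTree G T) : (SimpleGraph.fromEdgeSet (T : Set (Sym2 V))).Connected := by
  refine ((hG.maximal_le_isAcyclic_iff_isTree hT.le).1
    ⟨⟨hT.le, hT.prop.2⟩, fun H ⟨hHG, hH⟩ hTH => ?_⟩).connected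
  have hS : (H.edgeSet.toFinite.toFinset : Set (Sym2 V)) = H.edgeSet := Set.Finite.coe_toFinset _
  have hTS : T ≤ H.edgeSet.toFinite.toFinset := by
    intro e he
    rw [Set.Finite.mem_toFinset]
    refine SimpleGraph.edgeSet_mono hTH ?_
    rw [SimpleGraph.edgeSet_fromEdgeSet]
    exact ⟨he, G.not_isDiag_of_mem_edgeSet (hT.prop.1 he)⟩
  have hST := hT.2 (y := H.edgeSet.toFinite.toFinset)
    (by
      simp only [hS, SimpleGraph.fromEdgeSet_edgeSet]
      exact ⟨SimpleGraph.edgeSet_mono hHG, hH⟩) hTS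
  rw [← SimpleGraph.fromEdgeSet_edgeSet H, ← hS]
  exact SimpleGraph.fromEdgeSet_mono (Finset.coe_subset.2 hST)

theorem mem_spanningTrees [Fintype V] {T : Finset (Sym2 V)} :
    T ∈ spanningTrees G ↔ IsSpanningTree G T := by
  simp [spanningTrees]

theorem spanningTrees_nonempty [Fintype V] (G : SimpleGraph V) : (spanningTrees G).Nonempty := by
  obtain ⟨T, -, hT⟩ := Set.Finite.exists_le_maximal (Set.toFinite {S : Finset (Sym2 V) |
    (S : Set (Sym2 V)) ⊆ G.edgeSet ∧
      (SimpleGraph.fromEdgeSet (S : Set (Sym2 V))).IsAcyclic}) (a := ∅) (by simp)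
  exact ⟨T, mem_spanningTrees.2 hT⟩

theorem prod_pos_of_mem_spanningTrees [Fintype V] {c : Sym2 V → ℝ}
    (hc : ∀ e ∈ G.edgeSet, 0 < c e) {T : Finset (Sym2 V)} (hT : T ∈ spanningTrees G) :
    0 < ∏ t ∈ T, c t :=
  Finset.prod_pos fun e he => hc e ((mem_spanningTrees.1 hT).prop.1 he)

theorem kirchhoff_pos [Fintype V] {c : Sym2 V → ℝ} (hc : ∀ e ∈ G.edgeSet, 0 < c e) :
    0 < kirchhoff G c :=
  Finset.sum_pos (fun _ => prod_pos_of_mem_spanningTrees hc) (spanningTrees_nonempty G)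

open Classical in
/-- Up to the normalization by the Kirchhoff polynomial, the sum of the relative resistances at `v`
is the expected degree of `v` in the random spanning tree. -/
theorem kirchhoff_mul_sum_relativeResistance [Fintype V] {c : Sym2 V → ℝ}
    (hc : ∀ e ∈ G.edgeSet, 0 < c e) (v : V) :
    kirchhoff G c *
        ∑ u ∈ Finset.univ.filter (fun u => G.Adj u v), relativeResistance G c s(u, v) =
      ∑ T ∈ spanningTrees G, (∏ t ∈ T, c t) *
        ((SimpleGraph.fromEdgeSet (T : Set (Sym2 V))).degree v : ℝ) := by
  have hK := (kirchhoff_pos hc).ne'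
  simp only [relativeResistance, Finset.mul_sum, mul_div_cancel₀ _ hK]
  simp only [Finset.sum_filter (s := spanningTrees G)]
  rw [Finset.sum_comm]
  refine Finset.sum_congr rfl fun T hT => ?_
  rw [← Finset.sum_filter, Finset.sum_const, nsmul_eq_mul, mul_comm,
    ← SimpleGraph.card_neighborFinset_eq_degree, Finset.filter_filter]
  congr 3
  ext u
  have hsub : s(u, v) ∈ T → G.Adj u v := fun h => (mem_spanningTrees.1 hT).prop.1 h
  simp only [Finset.mem_filter, Finset.mem_univ, true_and, SimpleGraph.mem_neighborFinset,
    SimpleGraph.fromEdgeSet_adj, Finset.mem_coe, Sym2.eq_swap (a := v)]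
  exact ⟨fun h => ⟨h.2, h.1.ne'⟩, fun h => ⟨hsub h.1, h.1⟩⟩

open Classical in
/-- The expected total degree of `U` in the random spanning tree is at most `2 |U|`, so some
spanning tree does not exceed this value. -/
theorem exists_connected_sum_degree_le [Fintype V] (hG : G.Connected)
    (hRN : IsResistanceNonnegative G) (U : Finset V) :
    ∃ T : SimpleGraph V, T.Connected ∧ T ≤ G ∧ ∑ v ∈ U, T.degree v ≤ 2 * U.card := by
  obtain ⟨c, hc, hp⟩ := hRN
  suffices h : ∃ T ∈ spanningTrees G,
      (∏ t ∈ T, c t) * ∑ v ∈ U, ((SimpleGraph.fromEdgeSet (T : Set (Sym2 V))).degree v : ℝ) ≤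
        (∏ t ∈ T, c t) * (2 * U.card) by
    obtain ⟨T, hT, hle⟩ := h
    refine ⟨_, (mem_spanningTrees.1 hT).connected hG, (mem_spanningTrees.1 hT).le, ?_⟩
    have hdeg := le_of_mul_le_mul_left hle (prod_pos_of_mem_spanningTrees hc hT)
    norm_cast at hdeg
    convert! hdeg
  refine Finset.exists_le_of_sum_le (spanningTrees_nonempty G) ?_
  rw [← Finset.sum_mul]
  simp only [Finset.mul_sum]
  rw [Finset.sum_comm]
  simp only [← kirchhoff_mul_sum_relativeResistance hc]
  rw [← Finset.mul_sum]
  refine mul_le_mul_of_nonneg_left ?_ (kirchhoff_pos hc).le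
  rw [mul_comm, ← nsmul_eq_mul]
  refine Finset.sum_le_card_nsmul _ _ _ fun v _ => ?_
  have := hp v
  unfold resistanceCurvature at this
  linarith

theorem card_connectedComponent_deleteVerts_le [Fintype V] (hG : G.Connected)
    (hRN : IsResistanceNonnegative G) (U : Set V) :
    Nat.card ((⊤ : G.Subgraph).deleteVerts U).coe.ConnectedComponent ≤ U.ncard + 1 := by
  classical
  obtain ⟨T, hT, hle, hdeg⟩ := exists_connected_sum_degree_le hG hRN U.toFinset
  have h := SimpleGraph.card_connectedComponent_deleteVerts_le hT hle U
  rw [← Set.ncard_eq_toFinset_card'] at hdeg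
  omega

end ResistanceCurvature

theorem mainTheorem6 {V : Type*} [Fintype V] (G : SimpleGraph V) (hconn : G.Connected)
    (hRN : ResistanceCurvature.IsResistanceNonnegative G) :
    (Even (Fintype.card V) → ∃ M : G.Subgraph, M.IsPerfectMatching) ∧
    (Odd (Fintype.card V) →
      ∃ M : G.Subgraph, ResistanceCurvature.IsNearPerfectMatching M) := by
  have h := ResistanceCurvature.card_connectedComponent_deleteVerts_le hconn hRN
  rw [← Nat.card_eq_fintype_card]
  refine ⟨fun hV => SimpleGraph.exists_isPerfectMatching_of_card_connectedComponent_le hV h,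
    fun hV => ?_⟩
  obtain ⟨M, hM⟩ := SimpleGraph.exists_isPerfectMatching_of_card_connectedComponent_le
    (G := G.cone) (by rw [Finite.card_option]; exact hV.add_one)
    (SimpleGraph.card_connectedComponent_cone_deleteVerts_le h)
  exact SimpleGraph.exists_isNearPerfectMatching_of_cone hM
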